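/- Let $A\in\mathbb{R}^{m\times n}$ have rows $a_1^\top,\dots,a_m^\top$, let $b\in\mathbb{R}^m$, and suppose that the polytope $K=\{x\in\mathbb{R}^n : Ax\ge b\}$ is bounded and full-dimensional (has non-empty interior). For $x$ in the interior of $K$ let $$H(x)=\sum_{i=1}^m \frac{a_i a_i^\top}{(a_i^\top x-b_i)^2},\qquad F(x)=\tfrac12\ln\det H(x)$$ be the Hessian of the log-barrier $-\sum_{i=1}^m\ln(a_i^\top x-b_i)$ and the volumetric function (a term with $a_i=0$ is read as $0$; $F=+\infty$ on the boundary of $K$). Let $$\mathrm{cg}(K)=\frac{1}{\mathrm{vol}(K)}\int_K x\,dx,\qquad \mathrm{Cov}(K)=\frac{1}{\mathrm{vol}(K)}\int_K (x-\mathrm{cg}(K))(x-\mathrm{cg}(K))^\top dx$$ be the centroid of $K$ and the covariance matrix of the uniform distribution on $K$. Then $\mathrm{Cov}(K)$ is positive definite, $F$ attains its minimum over the interior of $K$, and for every minimizer $\mathrm{vc}(K)$ (volumetric center of $K$), $$\frac{1}{4m^3n^2}\,H(\mathrm{vc}(K))\ \preceq\ \mathrm{Cov}(K)^{-1}\ \preceq\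 4n^2\,H(\mathrm{vc}(K)),$$ where $X\preceq Y$ means that $Y-X$ is positive semidefinite. -/

import Mathlib

open MeasureTheory

noncomputable section

/-- The polyhedron `{x : A x ≥ b}` in `ℝⁿ` cut out by the `m` constraints `aᵢᵀ x ≥ bᵢ`. -/
def polytope {m n : ℕ} (A : Matrix (Fin m) (Fin n) ℝ) (b : Fin m → ℝ) : Set (Fin n → ℝ) :=
  {x | ∀ i, b i ≤ A.mulVec x i}

/-- `H(x) = ∑ᵢ aᵢ aᵢᵀ / (aᵢᵀ x - bᵢ)²`, the Hessian of the log-barrier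
`-∑ᵢ ln (aᵢᵀ x - bᵢ)`. -/
def barrierHessian {m n : ℕ} (A : Matrix (Fin m) (Fin n) ℝ) (b : Fin m → ℝ) (x : Fin n → ℝ) :
    Matrix (Fin n) (Fin n) ℝ :=
  ∑ i, (1 / (A.mulVec x i - b i) ^ 2) • Matrix.vecMulVec (A i) (A i)

/-- The volumetric function `F(x) = (1/2) ln det H(x)`. -/
def volumetricFunction {m n : ℕ} (A : Matrix (Fin m) (Fin n) ℝ) (b : Fin m → ℝ)
    (x : Fin n → ℝ) : ℝ :=
  1 / 2 * Real.log (barrierHessian A b x).det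

/-- `v` is a volumetric center, a minimizer of the volumetric function. The function is finite
on the interior of the polytope and `+∞` on its boundary, where some slack `aᵢᵀ x - bᵢ` with
`aᵢ ≠ 0` vanishes, so the minimization runs over the interior. -/
def IsVolumetricCenter {m n : ℕ} (A : Matrix (Fin m) (Fin n) ℝ) (b : Fin m → ℝ)
    (v : Fin n → ℝ) : Prop :=
  v ∈ interior (polytope A b) ∧
    ∀ x ∈ interior (polytope A b), volumetricFunction A b v ≤ volumetricFunction A b x

/-- The centroid `(1 / vol K) ∫_K x dx`. -/
def centroidOf {n : ℕ} (K : Set (Fin n → ℝ)) : Fin n → ℝ :=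
  (volume.real K)⁻¹ • ∫ x in K, x

/-- The covariance matrix `(1 / vol K) ∫_K (x - cg K) (x - cg K)ᵀ dx` of the uniform
distribution on `K`, written entrywise. -/
def covarianceMatrix {n : ℕ} (K : Set (Fin n → ℝ)) : Matrix (Fin n) (Fin n) ℝ :=
  Matrix.of fun i j =>
    (volume.real K)⁻¹ * ∫ x in K, (x i - centroidOf K i) * (x j - centroidOf K j)

end

/-! Testing against a linear functional `c`, both bounds compare `Cov(K)` with multiples of `H⁻¹`,
where `H = H(v)` at a volumetric center `v`.

Outer bound: put `yᵢ = aᵢᵀ(x - v)/(aᵢᵀv - bᵢ)` for `x ∈ K`. The leverage scores `σᵢ` sum to `n`,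
optimality of `v` gives `∑ σᵢ yᵢ ≤ 0`, and `yᵢ ≥ -1`; hence `∑ σᵢ|yᵢ| ≤ 2n`. With `S = ∑ yᵢ²` and
`yᵢ² ≤ σᵢ S`, this yields `S² ≤ m ∑ yᵢ⁴ ≤ 2mn S^(3/2)`, so `K` lies in the Dikin ellipsoid dilated
by `2mn` (`IsVolumetricCenter.dotProduct_barrierHessian_le`).

Inner bound: the Dikin ellipsoid lies in `K`, and no point of a convex body is further than
`√(n(n+2))` standard deviations from the centroid in any direction
(`sq_dotProduct_sub_centroidOf_le`).

A center exists because `det H` blows up at the boundary. -/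

/-! ### Determinant, trace and Loewner order -/

namespace Matrix

variable {ι : Type*} [Fintype ι] [DecidableEq ι]

/-- A positive semidefinite matrix of determinant at least one has trace at least its size. -/
theorem PosSemidef.card_le_trace {N : Matrix ι ι ℝ} (hN : N.PosSemidef) (hdet : 1 ≤ N.det) :
    (Fintype.card ι : ℝ) ≤ N.trace := by
  have hpos : N.PosDef := hN.posDef_iff_det_ne_zero.2 (by positivity)
  have hd : N.det = ∏ i, hN.1.eigenvalues i := by simpa using hN.1.det_eq_prod_eigenvalues
  have ht : N.trace = ∑ i, hN.1.eigenvalues i := by simpa using hN.1.trace_eq_sum_eigenvalues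
  have hlog : 0 ≤ ∑ i, Real.log (hN.1.eigenvalues i) := by
    rw [← Real.log_prod fun i _ => (hpos.eigenvalues_pos i).ne', ← hd]
    exact Real.log_nonneg hdet
  have hle : ∑ i, Real.log (hN.1.eigenvalues i) ≤ ∑ i, (hN.1.eigenvalues i - 1) :=
    Finset.sum_le_sum fun i _ => Real.log_le_sub_one_of_pos (hpos.eigenvalues_pos i)
  rw [Finset.sum_sub_distrib] at hle
  simp only [Finset.sum_const, Finset.card_univ, nsmul_eq_mul, mul_one] at hle
  linarith

open scoped MatrixOrder in
theorem PosSemidef.exists_eq_transpose_mul_self {P : Matrix ι ι ℝ} (hP : P.PosSemidef) :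
    ∃ B : Matrix ι ι ℝ, P = Bᵀ * B := by
  obtain ⟨B, hB⟩ := CStarAlgebra.nonneg_iff_eq_star_mul_self.1 (nonneg_iff_posSemidef.2 hP)
  exact ⟨B, by rw [hB, star_eq_conjTranspose, conjTranspose_eq_transpose_of_trivial]⟩

/-- With `P⁻¹ = Bᵀ B`, the trace is that of `B Q Bᵀ`, whose determinant is `det Q / det P ≥ 1`. This
turns minimality of `det H` into a trace inequality without differentiating a determinant. -/
theorem PosDef.card_le_trace_inv_mul {P Q : Matrix ι ι ℝ} (hP : P.PosDef) (hQ : Q.PosSemidef)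
    (h : P.det ≤ Q.det) : (Fintype.card ι : ℝ) ≤ (P⁻¹ * Q).trace := by
  obtain ⟨B, hB⟩ := hP.inv.posSemidef.exists_eq_transpose_mul_self
  have hN : (B * Q * Bᵀ).PosSemidef := by
    simpa [conjTranspose_eq_transpose_of_trivial] using hQ.mul_mul_conjTranspose_same B
  have hdet : (B * Q * Bᵀ).det = P.det⁻¹ * Q.det := by
    rw [det_mul, det_mul, ← Ring.inverse_eq_inv, ← det_nonsing_inv, hB, det_mul]; ring
  have htr : (P⁻¹ * Q).trace = (B * Q * Bᵀ).trace := by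
    rw [hB, Matrix.mul_assoc, trace_mul_comm]
  rw [htr]
  refine hN.card_le_trace ?_
  rw [hdet, inv_mul_eq_div, one_le_div hP.det_pos]
  exact h

/-- The Cauchy–Schwarz inequality for the dual norms given by a positive definite matrix. -/
theorem PosDef.sq_dotProduct_le {P : Matrix ι ι ℝ} (hP : P.PosDef) (a x : ι → ℝ) :
    (a ⬝ᵥ x) ^ 2 ≤ (a ⬝ᵥ P⁻¹ *ᵥ a) * (x ⬝ᵥ P *ᵥ x) := by
  by_cases ha : a = 0
  · simp [ha]
  have hpos : 0 < a ⬝ᵥ P⁻¹ *ᵥ a := by simpa using hP.inv.dotProduct_mulVec_pos ha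
  have hPi : P *ᵥ (P⁻¹ *ᵥ a) = a := by
    rw [mulVec_mulVec, mul_nonsing_inv _ hP.det_pos.ne'.isUnit, one_mulVec]
  have hsymm : (P⁻¹ *ᵥ a) ⬝ᵥ P *ᵥ x = a ⬝ᵥ x := by
    have hT : Pᵀ = P := by simpa [conjTranspose_eq_transpose_of_trivial] using hP.isHermitian.eq
    rw [dotProduct_mulVec, ← mulVec_transpose, hT, hPi]
  -- Up to scale, this vector is the residual of the `P`-orthogonal projection of `x` onto `P⁻¹ a`.
  have key := hP.posSemidef.dotProduct_mulVec_nonneg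
    ((a ⬝ᵥ P⁻¹ *ᵥ a) • x - (a ⬝ᵥ x) • (P⁻¹ *ᵥ a))
  simp only [star_trivial, mulVec_sub, mulVec_smul, sub_dotProduct, dotProduct_sub,
    smul_dotProduct, dotProduct_smul, smul_eq_mul, hPi, hsymm, dotProduct_comm x a,
    dotProduct_comm (P⁻¹ *ᵥ a) a] at key
  have : 0 ≤ (a ⬝ᵥ P⁻¹ *ᵥ a) * ((a ⬝ᵥ P⁻¹ *ᵥ a) * (x ⬝ᵥ P *ᵥ x) - (a ⬝ᵥ x) ^ 2) := by
    linarith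
  linarith [nonneg_of_mul_nonneg_right this hpos]

/-- Matrix inversion is antitone for the Loewner order. -/
theorem PosDef.posSemidef_inv_sub_inv {P Q : Matrix ι ι ℝ} (hP : P.PosDef) (hQ : Q.PosDef)
    (h : ∀ c, c ⬝ᵥ P *ᵥ c ≤ c ⬝ᵥ Q *ᵥ c) : (P⁻¹ - Q⁻¹).PosSemidef := by
  refine PosSemidef.of_dotProduct_mulVec_nonneg (hP.inv.isHermitian.sub hQ.inv.isHermitian) ?_
  intro x
  simp only [star_trivial, sub_mulVec, dotProduct_sub]
  have hPP : (P⁻¹)⁻¹ = P := nonsing_inv_nonsing_inv _ hP.det_pos.ne'.isUnit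
  -- Cauchy–Schwarz gives `(xᵀQ⁻¹x)² ≤ (Q⁻¹x)ᵀP(Q⁻¹x) · xᵀP⁻¹x`, and `P ⪯ Q` bounds the first factor
  -- by `xᵀQ⁻¹x`, which then cancels.
  have hcs := hP.inv.sq_dotProduct_le (Q⁻¹ *ᵥ x) x
  have hle := h (Q⁻¹ *ᵥ x)
  have hQi : Q *ᵥ (Q⁻¹ *ᵥ x) = x := by
    rw [mulVec_mulVec, mul_nonsing_inv _ hQ.det_pos.ne'.isUnit, one_mulVec]
  rw [hPP] at hcs
  rw [hQi] at hle
  have hq : (Q⁻¹ *ᵥ x) ⬝ᵥ x = x ⬝ᵥ Q⁻¹ *ᵥ x := dotProduct_comm _ _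
  rw [hq] at hcs hle
  have h0 : 0 ≤ x ⬝ᵥ P⁻¹ *ᵥ x := by simpa using hP.inv.posSemidef.dotProduct_mulVec_nonneg x
  by_cases hx : x = 0
  · simp [hx]
  have hpos : 0 < x ⬝ᵥ Q⁻¹ *ᵥ x := by simpa using hQ.inv.dotProduct_mulVec_pos hx
  have := hcs.trans (mul_le_mul_of_nonneg_right hle h0)
  rw [sq] at this
  linarith [le_of_mul_le_mul_left this hpos]

/-- All eigenvalues are at least `l`, so each one times `l ^ (card - 1)` is at most their product.
When `l > 0`, a bound on the determinant thus bounds the trace. -/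
theorem PosSemidef.pow_mul_trace_le_card_mul_det {P : Matrix ι ι ℝ} (hP : P.PosSemidef) {l : ℝ}
    (hl : 0 ≤ l) (h : ∀ x, l * (x ⬝ᵥ x) ≤ x ⬝ᵥ P *ᵥ x) :
    l ^ (Fintype.card ι - 1) * P.trace ≤ Fintype.card ι * P.det := by
  have hd : P.det = ∏ i, hP.1.eigenvalues i := by simpa using hP.1.det_eq_prod_eigenvalues
  have ht : P.trace = ∑ i, hP.1.eigenvalues i := by simpa using hP.1.trace_eq_sum_eigenvalues
  have hle : ∀ i, l ≤ hP.1.eigenvalues i := fun i => by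
    have h1 := h (hP.1.eigenvectorBasis i).ofLp
    have h2 := hP.1.eigenvalues_eq i
    have h3 : (hP.1.eigenvectorBasis i).ofLp ⬝ᵥ (hP.1.eigenvectorBasis i).ofLp = 1 := by
      have := hP.1.eigenvectorBasis.orthonormal.1 i
      have h4 := EuclideanSpace.real_norm_sq_eq (hP.1.eigenvectorBasis i)
      rw [this] at h4
      simp only [dotProduct, ← sq]
      linarith
    simp only [star_trivial, RCLike.re_to_real] at h2
    rw [h3, ← h2] at h1
    linarith
  have hprod : ∀ i, l ^ (Fintype.card ι - 1) * hP.1.eigenvalues i ≤ P.det := fun i => by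
    rw [hd, ← Finset.mul_prod_erase _ _ (Finset.mem_univ i), mul_comm]
    refine mul_le_mul_of_nonneg_left ?_ (hP.eigenvalues_nonneg i)
    have := Finset.prod_le_prod (s := Finset.univ.erase i) (fun _ _ => hl) (fun j _ => hle j)
    simpa [Finset.card_erase_of_mem] using this
  rw [ht, Finset.mul_sum]
  simpa using Finset.sum_le_card_nsmul Finset.univ _ _ fun i _ => hprod i

end Matrix

open Matrix Filter Topology
open scoped Pointwise

/-! ### Interior, barrier Hessian and existence of a center -/

section Polytope

variable {m n : ℕ} {A : Matrix (Fin m) (Fin n) ℝ} {b : Fin m → ℝ}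

theorem isClosed_polytope : IsClosed (polytope A b) := by
  simp only [polytope, Set.ofPred_forall]
  refine isClosed_iInter fun i => isClosed_le continuous_const ?_
  exact (continuous_apply i).comp (Continuous.matrix_mulVec continuous_const continuous_id)

theorem convex_polytope : Convex ℝ (polytope A b) := by
  intro x hx y hy s t hs ht hst i
  have h1 := mul_le_mul_of_nonneg_left (hx i) hs
  have h2 := mul_le_mul_of_nonneg_left (hy i) ht
  have h3 : b i = s * b i + t * b i := by rw [← add_mul, hst, one_mul]
  simp only [mulVec_add, mulVec_smul, Pi.add_apply, Pi.smul_apply, smul_eq_mul]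
  linarith

theorem continuous_mulVec_apply (i : Fin m) : Continuous fun x => (A *ᵥ x) i :=
  (continuous_apply i).comp (Continuous.matrix_mulVec continuous_const continuous_id)

/-- The constraints with a nonzero row are strict in the interior. -/
theorem lt_mulVec_of_mem_interior {x : Fin n → ℝ} (hx : x ∈ interior (polytope A b)) {i : Fin m}
    (hi : A i ≠ 0) : b i < (A *ᵥ x) i := by
  refine lt_of_le_of_ne (interior_subset hx i) fun heq => ?_
  -- Moving from `x` against `A i` would violate a tight constraint.
  have hc : Tendsto (fun t : ℝ => x - t • A i) (𝓝[>] 0) (𝓝 x) := by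
    have : Continuous fun t : ℝ => x - t • A i := by fun_prop
    simpa using (this.tendsto 0).mono_left nhdsWithin_le_nhds
  obtain ⟨t, ht, ht0⟩ := ((hc.eventually (mem_interior_iff_mem_nhds.1 hx)).and
    self_mem_nhdsWithin).exists
  have h := ht i
  have hAi : 0 < A i ⬝ᵥ A i := by simpa using dotProduct_star_self_pos_iff.2 hi
  have hmv : (A *ᵥ A i) i = A i ⬝ᵥ A i := rfl
  simp only [mulVec_sub, mulVec_smul, Pi.sub_apply, Pi.smul_apply, smul_eq_mul, hmv] at h
  have : 0 < t * (A i ⬝ᵥ A i) := mul_pos ht0 hAi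
  linarith

theorem mem_interior_polytope_iff (hfull : (interior (polytope A b)).Nonempty) {x : Fin n → ℝ} :
    x ∈ interior (polytope A b) ↔ ∀ i, A i ≠ 0 → b i < (A *ᵥ x) i := by
  refine ⟨fun hx i => lt_mulVec_of_mem_interior hx, fun h => ?_⟩
  obtain ⟨x₀, hx₀⟩ := hfull
  refine interior_maximal (s := polytope A b) (t := ⋂ i, {y | A i ≠ 0 → b i < (A *ᵥ y) i}) ?_ ?_
    (Set.mem_iInter.2 h)
  · intro y hy i
    by_cases hi : A i = 0
    · have h0 := interior_subset hx₀ i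
      simp only [mulVec, hi, zero_dotProduct] at h0 ⊢
      exact h0
    · exact (Set.mem_iInter.1 hy i hi).le
  · refine isOpen_iInter_of_finite fun i => ?_
    by_cases hi : A i = 0
    · simp [hi]
    · simpa [hi] using isOpen_lt continuous_const (continuous_mulVec_apply (A := A) i)

theorem mulVec_injective_of_isBounded (hb : Bornology.IsBounded (polytope A b))
    (hne : (polytope A b).Nonempty) {c : Fin n → ℝ} (hc : A *ᵥ c = 0) : c = 0 := by
  obtain ⟨x₀, hx₀⟩ := hne
  obtain ⟨R, hR⟩ := hb.exists_norm_le
  by_contra hne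
  have hcn : 0 < ‖c‖ := norm_pos_iff.2 hne
  have hR0 : 0 ≤ R := (norm_nonneg _).trans (hR _ hx₀)
  -- A kernel direction keeps the point in the polytope; a displacement of norm `R + ‖x₀‖ + 1`
  -- exceeds what the bound `R` allows.
  have h1 : x₀ + ((R + ‖x₀‖ + 1) / ‖c‖) • c ∈ polytope A b := fun i => by
    simpa [mulVec_add, mulVec_smul, hc] using hx₀ i
  have h2 := hR _ h1
  have h3 := norm_sub_le (x₀ + ((R + ‖x₀‖ + 1) / ‖c‖) • c) x₀
  rw [add_sub_cancel_left, norm_smul, Real.norm_of_nonneg (by positivity),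
    div_mul_cancel₀ _ hcn.ne'] at h3
  linarith

theorem dotProduct_barrierHessian_mulVec (x c : Fin n → ℝ) :
    c ⬝ᵥ barrierHessian A b x *ᵥ c = ∑ i, ((A *ᵥ c) i / ((A *ᵥ x) i - b i)) ^ 2 := by
  simp only [barrierHessian, sum_mulVec, dotProduct_sum, smul_mulVec, dotProduct_smul,
    vecMulVec_mulVec]
  refine Finset.sum_congr rfl fun i _ => ?_
  have h : (A *ᵥ c) i = A i ⬝ᵥ c := rfl
  rw [h, div_pow, dotProduct_comm c]
  simp
  ring

theorem isHermitian_barrierHessian (x : Fin n → ℝ) : (barrierHessian A b x).IsHermitian := by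
  ext i j
  simp only [barrierHessian, conjTranspose_apply, Matrix.sum_apply, Matrix.smul_apply, vecMulVec_apply,
    star_trivial, smul_eq_mul]
  exact Finset.sum_congr rfl fun k _ => by ring

theorem posSemidef_barrierHessian (x : Fin n → ℝ) : (barrierHessian A b x).PosSemidef := by
  refine .of_dotProduct_mulVec_nonneg (isHermitian_barrierHessian x) fun c => ?_
  rw [star_trivial, dotProduct_barrierHessian_mulVec]
  positivity

theorem trace_mul_barrierHessian (M : Matrix (Fin n) (Fin n) ℝ) (x : Fin n → ℝ) :
    (M * barrierHessian A b x).trace = ∑ i, (A i ⬝ᵥ M *ᵥ A i) / ((A *ᵥ x) i - b i) ^ 2 := by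
  simp only [barrierHessian, Finset.mul_sum, trace_sum, mul_smul_comm, trace_smul, mul_vecMulVec,
    trace_vecMulVec, smul_eq_mul]
  exact Finset.sum_congr rfl fun i _ => by rw [dotProduct_comm]; ring

theorem posDef_barrierHessian (hb : Bornology.IsBounded (polytope A b)) {x : Fin n → ℝ}
    (hx : x ∈ interior (polytope A b)) : (barrierHessian A b x).PosDef := by
  refine .of_dotProduct_mulVec_pos (isHermitian_barrierHessian x) fun c hc => ?_
  rw [star_trivial, dotProduct_barrierHessian_mulVec]
  have hAc : A *ᵥ c ≠ 0 := fun h => hc (mulVec_injective_of_isBounded hb ⟨x, interior_subset hx⟩ h)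
  obtain ⟨i, hi⟩ := Function.ne_iff.1 hAc
  have hAi : A i ≠ 0 := fun h => hi (by simp [mulVec, h])
  refine Finset.sum_pos' (fun _ _ => sq_nonneg _) ⟨i, Finset.mem_univ _, ?_⟩
  have := sub_pos.2 (lt_mulVec_of_mem_interior hx hAi)
  have hne : (A *ᵥ c) i / ((A *ᵥ x) i - b i) ≠ 0 := div_ne_zero hi this.ne'
  positivity

/-- The Dikin ellipsoid lies in the polytope. -/
theorem add_mem_polytope {v c : Fin n → ℝ} (hv : v ∈ interior (polytope A b))
    (hc : c ⬝ᵥ barrierHessian A b v *ᵥ c ≤ 1) : v + c ∈ polytope A b := by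
  intro i
  rw [mulVec_add, Pi.add_apply]
  by_cases hi : A i = 0
  · simpa [mulVec, hi] using interior_subset hv i
  have hs := sub_pos.2 (lt_mulVec_of_mem_interior hv hi)
  rw [dotProduct_barrierHessian_mulVec] at hc
  have h1 : ((A *ᵥ c) i / ((A *ᵥ v) i - b i)) ^ 2 ≤ 1 :=
    (Finset.single_le_sum (f := fun i => ((A *ᵥ c) i / ((A *ᵥ v) i - b i)) ^ 2)
      (fun _ _ => sq_nonneg _) (Finset.mem_univ i)).trans hc
  have h2 := (abs_le.1 ((sq_le_one_iff_abs_le_one _).1 h1)).1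
  rw [le_div_iff₀ hs] at h2
  linarith

/-- The volumetric function attains its minimum over the interior. -/
theorem exists_isVolumetricCenter (hb : Bornology.IsBounded (polytope A b))
    (hfull : (interior (polytope A b)).Nonempty) : ∃ v, IsVolumetricCenter A b v := by
  obtain ⟨x₀, hx₀⟩ := hfull
  rcases Nat.eq_zero_or_pos n with rfl | hn
  · exact ⟨x₀, hx₀, fun x _ => (congrArg _ (Subsingleton.elim x₀ x)).le⟩
  have hK : IsCompact (polytope A b) := Metric.isCompact_of_isClosed_isBounded isClosed_polytope hb
  -- a uniform bound on the slacks
  obtain ⟨R, hR0, hR⟩ : ∃ R : ℝ, 0 < R ∧ ∀ x ∈ polytope A b, ∀ i, (A *ᵥ x) i - b i ≤ R := by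
    have : ∀ i, ∃ r : ℝ, ∀ x ∈ polytope A b, (A *ᵥ x) i - b i ≤ r := fun i => by
      obtain ⟨r, hr⟩ := hK.bddAbove_image (f := fun x => (A *ᵥ x) i - b i)
        ((continuous_mulVec_apply i).sub continuous_const).continuousOn
      exact ⟨r, fun x hx => hr ⟨x, hx, rfl⟩⟩
    choose r hr using this
    refine ⟨1 + ∑ i, |r i|, by positivity, fun x hx i => (hr i x hx).trans ?_⟩
    have := Finset.single_le_sum (f := fun i => |r i|) (fun _ _ => abs_nonneg _) (Finset.mem_univ i)
    linarith [le_abs_self (r i)]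
  -- a uniform lower bound on the Hessians
  obtain ⟨l, hl0, hl⟩ : ∃ l : ℝ, 0 < l ∧ ∀ x ∈ interior (polytope A b), ∀ c : Fin n → ℝ,
      l * (c ⬝ᵥ c) ≤ c ⬝ᵥ barrierHessian A b x *ᵥ c := by
    have hP : (Aᵀ * A).PosDef := by
      rw [← conjTranspose_eq_transpose_of_trivial]
      refine PosDef.conjTranspose_mul_self A fun c d hcd => ?_
      refine sub_eq_zero.1 (mulVec_injective_of_isBounded hb ⟨x₀, interior_subset hx₀⟩ ?_)
      rw [mulVec_sub, sub_eq_zero]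
      exact hcd
    have : Nonempty (Fin n) := ⟨⟨0, hn⟩⟩
    have hT := hP.inv.trace_pos
    -- The trace comes from summing Cauchy–Schwarz against the basis vectors, the factor `(R ^ 2)⁻¹`
    -- from slacks at most `R`.
    refine ⟨((Aᵀ * A)⁻¹.trace)⁻¹ * (R ^ 2)⁻¹, by positivity, fun x hx c => ?_⟩
    have h1 : c ⬝ᵥ c ≤ (Aᵀ * A)⁻¹.trace * (c ⬝ᵥ (Aᵀ * A) *ᵥ c) := by
      have h : ∀ j, c j ^ 2 ≤ (Aᵀ * A)⁻¹ j j * (c ⬝ᵥ (Aᵀ * A) *ᵥ c) := fun j => by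
        simpa using hP.sq_dotProduct_le (Pi.single j 1) c
      simp only [trace, diag, Finset.sum_mul]
      refine (Finset.sum_le_sum fun j _ => ?_)
      rw [← sq]
      exact h j
    have h2 : c ⬝ᵥ (Aᵀ * A) *ᵥ c = ∑ i, (A *ᵥ c) i ^ 2 := by
      rw [← mulVec_mulVec, dotProduct_mulVec, vecMul_transpose]
      simp [dotProduct, sq]
    have h3 : (R ^ 2)⁻¹ * ∑ i, (A *ᵥ c) i ^ 2 ≤ c ⬝ᵥ barrierHessian A b x *ᵥ c := by
      rw [dotProduct_barrierHessian_mulVec, Finset.mul_sum]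
      refine Finset.sum_le_sum fun i _ => ?_
      by_cases hi : A i = 0
      · simp [mulVec, hi]
      have hs := sub_pos.2 (lt_mulVec_of_mem_interior hx hi)
      have hsR := hR x (interior_subset hx) i
      rw [div_pow, div_eq_inv_mul]
      gcongr
    rw [h2] at h1
    calc _ = (R ^ 2)⁻¹ * (((Aᵀ * A)⁻¹.trace)⁻¹ * (c ⬝ᵥ c)) := by ring
      _ ≤ (R ^ 2)⁻¹ * ∑ i, (A *ᵥ c) i ^ 2 := by
        gcongr
        rw [inv_mul_le_iff₀ hT]
        exact h1
      _ ≤ _ := h3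
  -- where the determinant is at most its value at `x₀`, the slacks are bounded below
  set D : ℝ := (barrierHessian A b x₀).det with hD
  have hD0 : 0 < D := (posDef_barrierHessian hb hx₀).det_pos
  have hslack : ∀ x ∈ interior (polytope A b), (barrierHessian A b x).det ≤ D → ∀ i,
      l ^ (n - 1) * (A i ⬝ᵥ A i) ≤ n * D * ((A *ᵥ x) i - b i) ^ 2 := fun x hx hxD i => by
    by_cases hi : A i = 0
    · simp only [hi, zero_dotProduct, mul_zero]; positivity
    have hs := sub_pos.2 (lt_mulVec_of_mem_interior hx hi)
    have h1 := (posSemidef_barrierHessian x).pow_mul_trace_le_card_mul_det hl0.le (hl x hx)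
    have h2 := trace_mul_barrierHessian (A := A) (b := b) 1 x
    simp only [one_mul, one_mulVec] at h2
    have h3 : (A i ⬝ᵥ A i) / ((A *ᵥ x) i - b i) ^ 2 ≤ (barrierHessian A b x).trace := by
      rw [h2]
      refine Finset.single_le_sum (f := fun i => (A i ⬝ᵥ A i) / ((A *ᵥ x) i - b i) ^ 2)
        (fun j _ => ?_) (Finset.mem_univ i)
      have : 0 ≤ A j ⬝ᵥ A j := by simpa using dotProduct_star_self_nonneg (A j)
      positivity
    rw [Fintype.card_fin] at h1
    have h4 : l ^ (n - 1) * ((A i ⬝ᵥ A i) / ((A *ᵥ x) i - b i) ^ 2) ≤ n * D :=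
      (mul_le_mul_of_nonneg_left h3 (by positivity)).trans (h1.trans (by gcongr))
    rwa [← mul_div_assoc, div_le_iff₀ (by positivity)] at h4
  -- At a vanishing slack the Hessian takes the junk value `1 / 0 = 0`, so a sublevel set of `det`
  -- need not be closed. The multiplied-out slack bound is a closed condition, and it forces
  -- positive slacks for nonzero rows.
  set C : Set (Fin n → ℝ) := polytope A b ∩
    ⋂ i, {x | l ^ (n - 1) * (A i ⬝ᵥ A i) ≤ n * D * ((A *ᵥ x) i - b i) ^ 2} with hCdef
  have hC : IsCompact C := by
    refine hK.inter_right (isClosed_iInter fun i => isClosed_le continuous_const ?_)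
    exact continuous_const.mul (((continuous_mulVec_apply i).sub continuous_const).pow 2)
  have hCint : C ⊆ interior (polytope A b) := fun x hx => by
    refine (mem_interior_polytope_iff ⟨x₀, hx₀⟩).2 fun i hi => ?_
    refine lt_of_le_of_ne (hx.1 i) fun heq => ?_
    have h := Set.mem_iInter.1 hx.2 i
    have hAi : 0 < A i ⬝ᵥ A i := by simpa using dotProduct_star_self_pos_iff.2 hi
    simp only [Set.mem_ofPred_eq, ← heq, sub_self, ne_eq, OfNat.ofNat_ne_zero, not_false_eq_true,
      zero_pow, mul_zero] at h
    exact absurd h (not_le.2 (by positivity))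
  have hcont : ContinuousOn (fun x => (barrierHessian A b x).det) C := by
    refine Continuous.comp_continuousOn (g := det) (Continuous.matrix_det continuous_id) ?_
    refine continuousOn_finsetSum _ fun i _ => ?_
    by_cases hi : A i = 0
    · simp only [hi, zero_vecMulVec, smul_zero]
      exact continuousOn_const
    · refine ContinuousOn.smul (continuousOn_const.div
        (((continuous_mulVec_apply i).sub continuous_const).pow 2).continuousOn fun x hx => ?_)
        continuousOn_const
      have := sub_pos.2 (lt_mulVec_of_mem_interior (hCint hx) hi)
      exact pow_ne_zero 2 this.ne'
  obtain ⟨v, hvC, hv⟩ := hC.exists_isMinOn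
    ⟨x₀, interior_subset hx₀, Set.mem_iInter.2 (hslack x₀ hx₀ le_rfl)⟩ hcont
  refine ⟨v, hCint hvC, fun x hx => ?_⟩
  have hvx : (barrierHessian A b v).det ≤ (barrierHessian A b x).det := by
    by_cases hxD : (barrierHessian A b x).det ≤ D
    · exact hv ⟨interior_subset hx, Set.mem_iInter.2 (hslack x hx hxD)⟩
    · exact (hv ⟨interior_subset hx₀, Set.mem_iInter.2 (hslack x₀ hx₀ le_rfl)⟩).trans
        (not_le.1 hxD).le
  have := Real.log_le_log (posDef_barrierHessian hb (hCint hvC)).det_pos hvx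
  unfold volumetricFunction
  linarith

/-! ### Leverage scores and the outer ellipsoid -/

/-- The leverage scores `σᵢ = aᵢᵀ H(x)⁻¹ aᵢ / (aᵢᵀ x - bᵢ)²`. -/
noncomputable def leverageScore (A : Matrix (Fin m) (Fin n) ℝ) (b : Fin m → ℝ) (x : Fin n → ℝ) (i : Fin m) : ℝ :=
  (A i ⬝ᵥ (barrierHessian A b x)⁻¹ *ᵥ A i) / ((A *ᵥ x) i - b i) ^ 2

theorem leverageScore_nonneg (x : Fin n → ℝ) (i : Fin m) : 0 ≤ leverageScore A b x i := by
  have := (posSemidef_barrierHessian (A := A) (b := b) x).inv.dotProduct_mulVec_nonneg (A i)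
  rw [star_trivial] at this
  exact div_nonneg this (sq_nonneg _)

theorem sum_leverageScore {x : Fin n → ℝ} (h : (barrierHessian A b x).PosDef) :
    ∑ i, leverageScore A b x i = n := by
  have := trace_mul_barrierHessian (A := A) (b := b) (barrierHessian A b x)⁻¹ x
  rw [nonsing_inv_mul _ h.det_pos.ne'.isUnit, trace_one, Fintype.card_fin] at this
  exact this.symm

theorem sq_div_slack_le {v : Fin n → ℝ} (h : (barrierHessian A b v).PosDef) (c : Fin n → ℝ)
    (i : Fin m) : ((A *ᵥ c) i / ((A *ᵥ v) i - b i)) ^ 2 ≤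
      leverageScore A b v i * (c ⬝ᵥ barrierHessian A b v *ᵥ c) := by
  rw [div_pow, leverageScore, div_mul_eq_mul_div]
  exact div_le_div_of_nonneg_right (h.sq_dotProduct_le (A i) c) (sq_nonneg _)

theorem neg_one_le_div_slack {v x : Fin n → ℝ} (hv : v ∈ interior (polytope A b))
    (hx : x ∈ polytope A b) (i : Fin m) :
    -1 ≤ (A *ᵥ (x - v)) i / ((A *ᵥ v) i - b i) := by
  by_cases hi : A i = 0
  · simp [mulVec, hi]
  have hs := sub_pos.2 (lt_mulVec_of_mem_interior hv hi)
  rw [le_div_iff₀ hs, mulVec_sub, Pi.sub_apply]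
  linarith [hx i]

/-- The first order optimality condition at a volumetric center. -/
theorem IsVolumetricCenter.sum_leverageScore_mul_nonpos (hb : Bornology.IsBounded (polytope A b))
    {v x : Fin n → ℝ} (hv : IsVolumetricCenter A b v) (hx : x ∈ polytope A b) :
    ∑ i, leverageScore A b v i * ((A *ᵥ (x - v)) i / ((A *ᵥ v) i - b i)) ≤ 0 := by
  set y : Fin m → ℝ := fun i => (A *ᵥ (x - v)) i / ((A *ᵥ v) i - b i) with hy
  -- For `0 ≤ t < 1`, `ψ t` is the trace of `H(v)⁻¹ H(v + t(x - v))`. It equals `n` at `t = 0` and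
  -- is at least `n` afterwards, so its derivative `-2 ∑ σᵢ yᵢ` at `0` is nonnegative.
  set ψ : ℝ → ℝ := fun t => ∑ i, leverageScore A b v i / (1 + t * y i) ^ 2 with hψ
  have hH := posDef_barrierHessian hb hv.1
  have hmin : ∀ t ∈ Set.Ioo (0 : ℝ) 1, ψ 0 ≤ ψ t := fun t ht => by
    have hmem : v + t • (x - v) ∈ interior (polytope A b) := by
      have := (convex_polytope (A := A) (b := b)).combo_interior_self_mem_interior hv.1 hx
        (sub_pos.2 ht.2) ht.1.le (by ring)
      convert this using 1
      module
    have hHt := posDef_barrierHessian hb hmem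
    have hlog := hv.2 _ hmem
    unfold volumetricFunction at hlog
    have hdet : (barrierHessian A b v).det ≤ (barrierHessian A b (v + t • (x - v))).det :=
      (Real.log_le_log_iff hH.det_pos hHt.det_pos).1 (by linarith)
    have htr := hH.card_le_trace_inv_mul hHt.posSemidef hdet
    rw [trace_mul_barrierHessian, Fintype.card_fin] at htr
    have h0 : ψ 0 = n := by simp [hψ, sum_leverageScore hH]
    rw [h0]
    refine htr.trans (Finset.sum_le_sum fun i _ => ?_)
    by_cases hi : A i = 0
    · simp [leverageScore, hi]
    have hs := sub_pos.2 (lt_mulVec_of_mem_interior hv.1 hi)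
    rw [leverageScore, div_div, ← mul_pow]
    refine le_of_eq ?_
    congr 2
    simp only [hy, mulVec_add, mulVec_smul, Pi.add_apply, Pi.smul_apply, smul_eq_mul]
    field_simp
    ring
  have hderiv : HasDerivAt ψ (∑ i, leverageScore A b v i * (-2 * y i)) 0 := by
    refine HasDerivAt.fun_sum fun i _ => ?_
    have h1 : HasDerivAt (fun t : ℝ => 1 + t * y i) (y i) 0 := by
      simpa using ((hasDerivAt_id (0 : ℝ)).mul_const (y i)).const_add 1
    have h2 := (h1.pow 2).inv (by simp)
    simp only [div_eq_mul_inv]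
    exact (h2.const_mul (leverageScore A b v i)).congr_deriv (by simp)
  have hslope := (hasDerivWithinAt_iff_tendsto_slope' (s := Set.Ioi 0) (by simp)).1
    hderiv.hasDerivWithinAt
  have hnonneg := ge_of_tendsto hslope (b := 0) (by
    filter_upwards [Ioo_mem_nhdsGT (zero_lt_one' ℝ)] with t ht
    rw [slope_def_field]
    exact div_nonneg (sub_nonneg.2 (hmin t ht)) (by simpa using ht.1.le))
  have : ∑ i, leverageScore A b v i * (-2 * y i) = -2 * ∑ i, leverageScore A b v i * y i := by
    rw [Finset.mul_sum]
    exact Finset.sum_congr rfl fun i _ => by ring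
  linarith

/-- The polytope lies in the Dikin ellipsoid of a volumetric center dilated by `2 m n`. -/
theorem IsVolumetricCenter.dotProduct_barrierHessian_le (hb : Bornology.IsBounded (polytope A b))
    {v x : Fin n → ℝ} (hv : IsVolumetricCenter A b v) (hx : x ∈ polytope A b) :
    (x - v) ⬝ᵥ barrierHessian A b v *ᵥ (x - v) ≤ (2 * m * n : ℝ) ^ 2 := by
  have hH := posDef_barrierHessian hb hv.1
  set S := (x - v) ⬝ᵥ barrierHessian A b v *ᵥ (x - v) with hS
  set y : Fin m → ℝ := fun i => (A *ᵥ (x - v)) i / ((A *ᵥ v) i - b i) with hy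
  set s := leverageScore A b v
  have hs0 : ∀ i, 0 ≤ s i := leverageScore_nonneg v
  have hSy : S = ∑ i, y i ^ 2 := dotProduct_barrierHessian_mulVec v (x - v)
  have hS0 : 0 ≤ S := hSy ▸ Finset.sum_nonneg fun _ _ => sq_nonneg _
  have hyS : ∀ i, y i ^ 2 ≤ s i * S := sq_div_slack_le hH (x - v)
  have habs : ∀ i, |y i| ≤ √S := fun i => by
    refine Real.abs_le_sqrt ?_
    rw [hSy]
    exact Finset.single_le_sum (f := fun i => y i ^ 2) (fun _ _ => sq_nonneg _) (Finset.mem_univ i)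
  have hsum : ∑ i, s i * |y i| ≤ 2 * n := by
    have h1 : ∀ i, s i * |y i| ≤ s i * y i + 2 * s i := fun i => by
      have h2 : -1 ≤ y i := neg_one_le_div_slack hv.1 hx i
      have h3 : |y i| ≤ y i + 2 := abs_le.2 ⟨by linarith, by linarith⟩
      linarith [mul_le_mul_of_nonneg_left h3 (hs0 i)]
    have h4 := Finset.sum_le_sum fun i (_ : i ∈ Finset.univ) => h1 i
    rw [Finset.sum_add_distrib, ← Finset.mul_sum, sum_leverageScore hH] at h4
    linarith [hv.sum_leverageScore_mul_nonpos hb hx]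
  have hmain : S ^ 2 ≤ m * (S * (√S * (2 * n))) := by
    have hcs : S ^ 2 ≤ m * ∑ i, (y i ^ 2) ^ 2 := by
      rw [hSy]
      simpa using sq_sum_le_card_mul_sum_sq (s := Finset.univ) (f := fun i => y i ^ 2)
    refine hcs.trans (mul_le_mul_of_nonneg_left ?_ (Nat.cast_nonneg m))
    calc ∑ i, (y i ^ 2) ^ 2 ≤ ∑ i, S * (√S * (s i * |y i|)) := by
          refine Finset.sum_le_sum fun i _ => ?_
          have h1 : y i ^ 2 ≤ √S * |y i| := by
            rw [← sq_abs, sq]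
            exact mul_le_mul_of_nonneg_right (habs i) (abs_nonneg _)
          calc (y i ^ 2) ^ 2 = y i ^ 2 * y i ^ 2 := sq _
            _ ≤ (s i * S) * (√S * |y i|) :=
              mul_le_mul (hyS i) h1 (sq_nonneg _) (mul_nonneg (hs0 i) hS0)
            _ = _ := by ring
      _ = S * (√S * ∑ i, s i * |y i|) := by rw [← Finset.mul_sum, ← Finset.mul_sum]
      _ ≤ S * (√S * (2 * n)) := by gcongr
  -- The case `S = 0` is separate because `S` and `√S` are cancelled below.
  rcases hS0.eq_or_lt with h0 | hpos
  · rw [← h0]; positivity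
  have hr : 0 < √S := Real.sqrt_pos.2 hpos
  have hsq : √S * √S = S := Real.mul_self_sqrt hS0
  have h1 : S ≤ m * (√S * (2 * n)) :=
    le_of_mul_le_mul_left (by linarith [sq S] : S * S ≤ S * (m * (√S * (2 * n)))) hpos
  have h2 : √S ≤ 2 * m * n :=
    le_of_mul_le_mul_left (by linarith : √S * √S ≤ √S * (2 * m * n)) hr
  calc S = √S ^ 2 := by rw [sq, hsq]
    _ ≤ _ := by gcongr

end Polytope

/-! ### Covariance of a convex body -/

section Covariance

variable {n : ℕ} {K : Set (Fin n → ℝ)}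

theorem dotProduct_covarianceMatrix_mulVec (hK : IsCompact K) (c : Fin n → ℝ) :
    c ⬝ᵥ covarianceMatrix K *ᵥ c =
      (volume.real K)⁻¹ * ∫ x in K, (c ⬝ᵥ x - c ⬝ᵥ centroidOf K) ^ 2 := by
  have hint : ∀ i j, IntegrableOn
      (fun x : Fin n → ℝ => c i * c j * ((x i - centroidOf K i) * (x j - centroidOf K j))) K := by
    intro i j
    refine ContinuousOn.integrableOn_compact hK (Continuous.continuousOn ?_)
    fun_prop
  have hsq : ∀ x : Fin n → ℝ, (c ⬝ᵥ x - c ⬝ᵥ centroidOf K) ^ 2 =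
      ∑ i, ∑ j, c i * c j * ((x i - centroidOf K i) * (x j - centroidOf K j)) := fun x => by
    rw [← dotProduct_sub, sq, dotProduct, Finset.sum_mul_sum]
    refine Finset.sum_congr rfl fun i _ => Finset.sum_congr rfl fun j _ => ?_
    simp only [Pi.sub_apply]
    ring
  simp only [hsq]
  rw [integral_finsetSum _ fun i _ => integrable_finsetSum _ fun j _ => hint i j, Finset.mul_sum]
  refine Finset.sum_congr rfl fun i _ => ?_
  rw [integral_finsetSum _ fun j _ => hint i j, Finset.mul_sum, mulVec, dotProduct, Finset.mul_sum]
  refine Finset.sum_congr rfl fun j _ => ?_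
  rw [integral_const_mul, covarianceMatrix, of_apply]
  ring

theorem isHermitian_covarianceMatrix : (covarianceMatrix K).IsHermitian := by
  ext i j
  simp [covarianceMatrix, mul_comm]

theorem integrableOn_of_continuous_of_isCompact (hK : IsCompact K) {f : (Fin n → ℝ) → ℝ}
    (hf : Continuous f) : IntegrableOn f K :=
  hf.continuousOn.integrableOn_compact hK

theorem setIntegral_dotProduct_sub_centroidOf (hK : IsCompact K) (hvol : 0 < volume.real K)
    (c : Fin n → ℝ) : ∫ x in K, (c ⬝ᵥ x - c ⬝ᵥ centroidOf K) = 0 := by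
  have hid : IntegrableOn (fun x : Fin n → ℝ => x) K :=
    continuous_id.continuousOn.integrableOn_compact hK
  have hc : ∫ x in K, c ⬝ᵥ x = c ⬝ᵥ ∫ x in K, x := by
    let L : (Fin n → ℝ) →L[ℝ] ℝ := LinearMap.toContinuousLinearMap (dotProductBilin ℝ ℝ c)
    exact L.integral_comp_comm hid
  rw [integral_sub (integrableOn_of_continuous_of_isCompact hK (by fun_prop))
    (integrableOn_of_continuous_of_isCompact hK continuous_const), hc, centroidOf,
    dotProduct_smul, setIntegral_const, smul_eq_mul, smul_eq_mul, mul_inv_cancel_left₀ hvol.ne',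
    sub_self]

/-- The second moment of a linear functional about a point, in terms of the covariance. -/
theorem setIntegral_sq_dotProduct_sub (hK : IsCompact K) (hvol : 0 < volume.real K)
    (c : Fin n → ℝ) (t a : ℝ) :
    ∫ x in K, (t * (c ⬝ᵥ x - c ⬝ᵥ centroidOf K) + a) ^ 2 =
      volume.real K * (t ^ 2 * (c ⬝ᵥ covarianceMatrix K *ᵥ c) + a ^ 2) := by
  have hexp : ∀ x : Fin n → ℝ, (t * (c ⬝ᵥ x - c ⬝ᵥ centroidOf K) + a) ^ 2 =
      t ^ 2 * (c ⬝ᵥ x - c ⬝ᵥ centroidOf K) ^ 2 +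
        (2 * t * a * (c ⬝ᵥ x - c ⬝ᵥ centroidOf K) + a ^ 2) := fun x => by ring
  have hi : ∀ {f : (Fin n → ℝ) → ℝ}, Continuous f → IntegrableOn f K :=
    integrableOn_of_continuous_of_isCompact hK
  simp only [hexp]
  rw [integral_add (hi (by fun_prop)) (hi (by fun_prop)),
    integral_add (hi (by fun_prop)) (hi (by fun_prop)), integral_const_mul, integral_const_mul,
    setIntegral_dotProduct_sub_centroidOf hK hvol, setIntegral_const,
    dotProduct_covarianceMatrix_mulVec hK, smul_eq_mul]
  field_simp
  ring

theorem dotProduct_covarianceMatrix_mulVec_nonneg (hK : IsCompact K) (c : Fin n → ℝ) :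
    0 ≤ c ⬝ᵥ covarianceMatrix K *ᵥ c := by
  rw [dotProduct_covarianceMatrix_mulVec hK]
  exact mul_nonneg (inv_nonneg.2 measureReal_nonneg) (integral_nonneg fun _ => sq_nonneg _)

/-- The variance of a linear functional is at most any bound for its squared distance to a
constant. -/
theorem dotProduct_covarianceMatrix_mulVec_le (hK : IsCompact K) (hvol : 0 < volume.real K)
    {c : Fin n → ℝ} {a r : ℝ} (h : ∀ x ∈ K, (c ⬝ᵥ x - a) ^ 2 ≤ r) :
    c ⬝ᵥ covarianceMatrix K *ᵥ c ≤ r := by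
  have h1 := setIntegral_sq_dotProduct_sub hK hvol c 1 (c ⬝ᵥ centroidOf K - a)
  have h2 : ∫ x in K, (1 * (c ⬝ᵥ x - c ⬝ᵥ centroidOf K) + (c ⬝ᵥ centroidOf K - a)) ^ 2 ≤
      ∫ _ in K, r := by
    refine setIntegral_mono_on (integrableOn_of_continuous_of_isCompact hK (by fun_prop))
      (integrableOn_of_continuous_of_isCompact hK continuous_const) hK.measurableSet fun x hx => ?_
    have h3 : 1 * (c ⬝ᵥ x - c ⬝ᵥ centroidOf K) + (c ⬝ᵥ centroidOf K - a) = c ⬝ᵥ x - a := by ring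
    rw [h3]
    exact h x hx
  rw [h1, setIntegral_const, smul_eq_mul] at h2
  have := le_of_mul_le_mul_left h2 hvol
  nlinarith [sq_nonneg (c ⬝ᵥ centroidOf K - a)]

/-- Shrinking a convex body towards one of its points does not increase the integral of a
nonnegative function. -/
theorem pow_mul_setIntegral_comp_homothety_le (hK : IsCompact K) (hconv : Convex ℝ K)
    {p : Fin n → ℝ} (hp : p ∈ K) {t : ℝ} (ht0 : 0 < t) (ht1 : t ≤ 1) {g : (Fin n → ℝ) → ℝ}
    (hg : Continuous g) (hg0 : ∀ x, 0 ≤ g x) :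
    t ^ n * ∫ x in K, g ((1 - t) • p + t • x) ≤ ∫ x in K, g x := by
  have h1 := Measure.setIntegral_comp_smul_of_pos volume (fun y => g ((1 - t) • p + y)) K ht0
  -- The factor `t ^ n` is the Jacobian of the homothety, whose image lies in `K` by convexity.
  have h2 := (measurePreserving_add_left (volume : Measure (Fin n → ℝ))
    ((1 - t) • p)).setIntegral_image_emb (measurableEmbedding_addLeft _) g (t • K)
  rw [h1, ← h2, Module.finrank_fin_fun, smul_eq_mul, mul_inv_cancel_left₀ (by positivity)]
  refine setIntegral_mono_set (integrableOn_of_continuous_of_isCompact hK hg)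
    (.of_forall hg0) (Filter.Eventually.of_forall ?_)
  rintro _ ⟨_, ⟨x, hx, rfl⟩, rfl⟩
  exact hconv hp hx (sub_nonneg.2 ht1) ht0.le (by ring)

/-- The inequality `(c · (p - cg K))² ≤ n (n + 2) Var (c · X)` for `X` uniform on a convex body `K`
and `p ∈ K`. -/
theorem sq_dotProduct_sub_centroidOf_le (hK : IsCompact K) (hconv : Convex ℝ K)
    (hvol : 0 < volume.real K) (hn : n ≠ 0) {p : Fin n → ℝ} (hp : p ∈ K) (c : Fin n → ℝ) :
    (c ⬝ᵥ p - c ⬝ᵥ centroidOf K) ^ 2 ≤ n * (n + 2) * (c ⬝ᵥ covarianceMatrix K *ᵥ c) := by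
  set M := c ⬝ᵥ p - c ⬝ᵥ centroidOf K with hM
  set V := c ⬝ᵥ covarianceMatrix K *ᵥ c with hV
  have hn' : (0 : ℝ) < n := by positivity
  -- Shrinking towards `p`, applied to the squared distance of `c ⬝ᵥ (x - cg K)` from `a`, after
  -- division by the volume.
  have hineq : ∀ a t : ℝ, 0 < t → t ≤ 1 →
      t ^ n * (t ^ 2 * V + ((1 - t) * M - a) ^ 2) ≤ V + a ^ 2 := fun a t ht0 ht1 => by
    have h := pow_mul_setIntegral_comp_homothety_le hK hconv hp ht0 ht1
      (g := fun x => (1 * (c ⬝ᵥ x - c ⬝ᵥ centroidOf K) + -a) ^ 2) (by fun_prop)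
      (fun _ => sq_nonneg _)
    have hl : ∀ x : Fin n → ℝ,
        1 * (c ⬝ᵥ ((1 - t) • p + t • x) - c ⬝ᵥ centroidOf K) + -a =
        t * (c ⬝ᵥ x - c ⬝ᵥ centroidOf K) + ((1 - t) * M - a) := fun x => by
      simp only [hM, dotProduct_add, dotProduct_smul, smul_eq_mul]
      ring
    simp only [hl] at h
    rw [setIntegral_sq_dotProduct_sub hK hvol, setIntegral_sq_dotProduct_sub hK hvol,
      mul_left_comm] at h
    simpa using le_of_mul_le_mul_left h hvol
  -- `hineq` is an equality at `t = 1`, so the left-hand side has nonnegative derivative there.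
  have hfirst : ∀ a : ℝ, 0 ≤ n * (V + a ^ 2) + (2 * V + 2 * a * M) := fun a => by
    set φ : ℝ → ℝ := fun t => t ^ n * (t ^ 2 * V + ((1 - t) * M - a) ^ 2) with hφ
    have hderiv : HasDerivAt φ (n * (V + a ^ 2) + (2 * V + 2 * a * M)) 1 := by
      have h1 : HasDerivAt (fun t : ℝ => (1 - t) * M - a) (-M) 1 := by
        simpa using (((hasDerivAt_id (1 : ℝ)).const_sub 1).mul_const M).sub_const a
      have h2 := (hasDerivAt_pow n (1 : ℝ)).mul
        (((hasDerivAt_pow 2 (1 : ℝ)).mul_const V).add (h1.pow 2))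
      exact h2.congr_deriv (by simp)
    have hslope := (hasDerivWithinAt_iff_tendsto_slope' (s := Set.Iio 1) (by simp)).1
      hderiv.hasDerivWithinAt
    refine ge_of_tendsto hslope ?_
    filter_upwards [Ioo_mem_nhdsLT (zero_lt_one' ℝ)] with t ht
    rw [slope_def_field]
    refine div_nonneg_of_nonpos ?_ (by linarith [ht.2])
    have h3 : φ 1 = V + a ^ 2 := by simp [hφ]
    rw [h3]
    linarith [hineq a t ht.1 ht.2.le]
  -- This `a` minimizes `n a² + 2 a M`.
  have h := hfirst (-(M / n))
  have h' : n * (V + (-(M / n)) ^ 2) + (2 * V + 2 * (-(M / n)) * M) =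
      (n * (n + 2) * V - M ^ 2) / n := by
    field_simp
    ring
  rw [h', le_div_iff₀ hn', zero_mul] at h
  linarith

/-- By the preceding inequality, zero variance makes `c ⬝ᵥ x` constant on `K`, which a nonempty
interior forbids unless `c = 0`. -/
theorem posDef_covarianceMatrix (hK : IsCompact K) (hconv : Convex ℝ K)
    (hne : (interior K).Nonempty) (hvol : 0 < volume.real K) : (covarianceMatrix K).PosDef := by
  refine .of_dotProduct_mulVec_pos isHermitian_covarianceMatrix fun c hc => ?_
  rw [star_trivial]
  refine lt_of_le_of_ne (dotProduct_covarianceMatrix_mulVec_nonneg hK c) fun h0 => hc ?_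
  have hn : n ≠ 0 := by
    rintro rfl
    exact hc (Subsingleton.elim _ _)
  have hconst : ∀ p ∈ K, c ⬝ᵥ p = c ⬝ᵥ centroidOf K := fun p hp => by
    have h := sq_dotProduct_sub_centroidOf_le hK hconv hvol hn hp c
    rw [← h0, mul_zero] at h
    exact sub_eq_zero.1 (pow_eq_zero_iff two_ne_zero |>.1 (le_antisymm h (sq_nonneg _)))
  obtain ⟨x, hx⟩ := hne
  have htend : Tendsto (fun t : ℝ => x + t • c) (𝓝[>] 0) (𝓝 x) := by
    have : Continuous fun t : ℝ => x + t • c := by fun_prop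
    simpa using (this.tendsto 0).mono_left nhdsWithin_le_nhds
  obtain ⟨t, ht, ht0⟩ := ((htend.eventually (mem_interior_iff_mem_nhds.1 hx)).and
    self_mem_nhdsWithin).exists
  have h1 := hconst _ ht
  rw [dotProduct_add, hconst x (interior_subset hx), dotProduct_smul, smul_eq_mul,
    add_eq_left] at h1
  exact dotProduct_self_eq_zero.1 ((mul_eq_zero.1 h1).resolve_left (ne_of_gt ht0))

end Covariance

/-! ### The two Loewner bounds -/

theorem lemma4p6 (m n : ℕ) (A : Matrix (Fin m) (Fin n) ℝ) (b : Fin m → ℝ)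
    (hbounded : Bornology.IsBounded (polytope A b))
    (hfull : (interior (polytope A b)).Nonempty) :
    (covarianceMatrix (polytope A b)).PosDef ∧
    (∃ v, IsVolumetricCenter A b v) ∧
    ∀ v, IsVolumetricCenter A b v →
      ((covarianceMatrix (polytope A b))⁻¹ -
        (1 / (4 * (m : ℝ) ^ 3 * (n : ℝ) ^ 2)) • barrierHessian A b v).PosSemidef ∧
      ((4 * (n : ℝ) ^ 2) • barrierHessian A b v -
        (covarianceMatrix (polytope A b))⁻¹).PosSemidef := by
  have hK : IsCompact (polytope A b) :=
    Metric.isCompact_of_isClosed_isBounded isClosed_polytope hbounded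
  have hvol : 0 < volume.real (polytope A b) :=
    ENNReal.toReal_pos (Measure.measure_pos_of_nonempty_interior volume hfull).ne' hK.measure_lt_top.ne
  have hCov := posDef_covarianceMatrix hK convex_polytope hfull hvol
  refine ⟨hCov, exists_isVolumetricCenter hbounded hfull, fun v hv => ?_⟩
  rcases Nat.eq_zero_or_pos n with rfl | hn
  · have hzero : ∀ M : Matrix (Fin 0) (Fin 0) ℝ, M.PosSemidef := fun M => by
      rw [Subsingleton.elim M 0]
      exact .zero
    exact ⟨hzero _, hzero _⟩
  have hH := posDef_barrierHessian hbounded hv.1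
  have hm : 0 < m := by
    rcases Nat.eq_zero_or_pos m with rfl | hm
    · have h := hH.dotProduct_mulVec_pos (x := fun _ => 1)
        (Function.ne_iff.2 ⟨⟨0, hn⟩, one_ne_zero⟩)
      simp [barrierHessian] at h
    · exact hm
  have hn1 : (1 : ℝ) ≤ n := by exact_mod_cast hn
  have hm1 : (1 : ℝ) ≤ m := by exact_mod_cast hm
  have hinv_smul : ∀ {k : ℝ}, k ≠ 0 → (k • (barrierHessian A b v)⁻¹)⁻¹ =
      k⁻¹ • barrierHessian A b v := fun {k} hk => by
    refine inv_eq_right_inv ?_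
    rw [smul_mul_smul_comm, mul_inv_cancel₀ hk, one_smul,
      nonsing_inv_mul _ hH.det_pos.ne'.isUnit]
  have hform : ∀ (k : ℝ) (c : Fin n → ℝ), c ⬝ᵥ (k • (barrierHessian A b v)⁻¹) *ᵥ c =
      k * (c ⬝ᵥ (barrierHessian A b v)⁻¹ *ᵥ c) := fun k c => by
    rw [smul_mulVec, dotProduct_smul, smul_eq_mul]
  have hinv_nonneg : ∀ c : Fin n → ℝ, 0 ≤ c ⬝ᵥ (barrierHessian A b v)⁻¹ *ᵥ c := fun c => by
    simpa using hH.inv.posSemidef.dotProduct_mulVec_nonneg c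
  constructor
  · have hk : (0 : ℝ) < 4 * m ^ 3 * n ^ 2 := by positivity
    have h := hCov.posSemidef_inv_sub_inv (hH.inv.smul hk) fun c => ?_
    · rw [one_div]
      rwa [hinv_smul hk.ne'] at h
    rw [hform]
    refine dotProduct_covarianceMatrix_mulVec_le (a := c ⬝ᵥ v) hK hvol fun x hx => ?_
    rw [← dotProduct_sub, mul_comm]
    refine (hH.sq_dotProduct_le c (x - v)).trans (mul_le_mul_of_nonneg_left ?_ (hinv_nonneg c))
    refine (hv.dotProduct_barrierHessian_le hbounded hx).trans ?_
    -- The dilation `2mn` gives the constant `4m²n²`; it is relaxed to `4m³n²` using `m ≥ 1`.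
    have hpow : (m : ℝ) ^ 2 ≤ (m : ℝ) ^ 3 := pow_le_pow_right₀ hm1 (by norm_num)
    rw [mul_pow, mul_pow]
    norm_num
    gcongr
  · have hk : (0 : ℝ) < 4 * n ^ 2 := by positivity
    have h := (hH.inv.smul (inv_pos.2 hk)).posSemidef_inv_sub_inv hCov fun c => ?_
    · rwa [hinv_smul (inv_pos.2 hk).ne', inv_inv] at h
    rw [hform, inv_mul_le_iff₀ hk]
    set q := c ⬝ᵥ (barrierHessian A b v)⁻¹ *ᵥ c with hq
    rcases (hinv_nonneg c).eq_or_lt with h0 | hpos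
    · rw [hq, ← h0]
      exact mul_nonneg hk.le (dotProduct_covarianceMatrix_mulVec_nonneg hK c)
    -- the points `v ± u` of the Dikin ellipsoid that are extremal in the direction `c`
    set u := (√q)⁻¹ • ((barrierHessian A b v)⁻¹ *ᵥ c) with hu
    have hsq : √q * √q = q := Real.mul_self_sqrt hpos.le
    have hr : 0 < √q := Real.sqrt_pos.2 hpos
    have hcu : c ⬝ᵥ u = √q := by
      rw [hu, dotProduct_smul, smul_eq_mul, ← hq, inv_mul_eq_iff_eq_mul₀ hr.ne', hsq]
    have hHu : u ⬝ᵥ barrierHessian A b v *ᵥ u = 1 := by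
      rw [hu, mulVec_smul, mulVec_mulVec, mul_nonsing_inv _ hH.det_pos.ne'.isUnit, one_mulVec,
        dotProduct_smul, ← hu, dotProduct_comm, hcu, smul_eq_mul, inv_mul_cancel₀ hr.ne']
    have h1 := sq_dotProduct_sub_centroidOf_le hK convex_polytope hvol hn.ne'
      (add_mem_polytope hv.1 hHu.le) c
    have h2 := sq_dotProduct_sub_centroidOf_le hK convex_polytope hvol hn.ne'
      (add_mem_polytope (c := -u) hv.1 (by simp [mulVec_neg, hHu])) c
    rw [dotProduct_add, hcu] at h1
    rw [dotProduct_add, dotProduct_neg, hcu] at h2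
    have h3 : (n * (n + 2) : ℝ) * (c ⬝ᵥ covarianceMatrix (polytope A b) *ᵥ c) ≤
        4 * n ^ 2 * (c ⬝ᵥ covarianceMatrix (polytope A b) *ᵥ c) := by
      refine mul_le_mul_of_nonneg_right ?_ (dotProduct_covarianceMatrix_mulVec_nonneg hK c)
      nlinarith
    -- With `d = c ⬝ᵥ v - c ⬝ᵥ cg K`, adding the bounds for `d ± √q` gives `2d² + 2q ≤ 2n(n+2)V`,
    -- where `V` is the variance of `c`; then `d²` is dropped.
    nlinarith [sq_nonneg (c ⬝ᵥ v - c ⬝ᵥ centroidOf (polytope A b))]
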